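/- Let $n\ge 0$ and let $M$ be a smooth manifold of dimension $2n+1$ with an almost contact metric structure $(\phi,\xi,\eta,g)$: $\phi$ is a smooth $(1,1)$-tensor field, $\xi$ a smooth vector field, $\eta$ a smooth $1$-form and $g$ a Riemannian metric, with $$\phi^2=-\mathrm{Id}+\eta\otimes\xi,\qquad \eta(\xi)=1,\qquad g(\phi X,\phi Y)=g(X,Y)-\eta(X)\eta(Y).$$ Let $\Phi(X,Y)=g(X,\phi Y)$ be its second fundamental form, a $2$-form, and let $f:M\to\mathbb R$ be smooth. For a smooth function $h$, an almost contact metric structure is called almost generalized $h$-cosymplectic if $d\eta=0$ and $d\Phi=2h\,\eta\wedge\Phi$. The manifold $(M,\phi,\xi,\eta,g)$ is called locally conformal almost generalized $f$-cosymplectic if there are an open covering $\{U_t\}_{t\in I}$ of $M$ and smooth functions $\sigma_t:U_t\to\mathbb R$ such that, on each $U_t$, the rescaled structure $$\phi_t=\phi,\quad \xi_t=e^{\sigma_t}\xi,\quad \eta_t=e^{-\sigma_t}\eta,\quad g_t=e^{-2\sigma_t}g$$ is almost generalized $fe^{\sigma_t}$-cosymplectic; we then say that $(U_t,\sigma_t)_{t\in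 I}$ realizes this property. Call a smooth closed $1$-form $\omega$ on $M$ a Lee form if $$d\eta=\omega\wedge\eta\qquad\text{and}\qquad d\Phi=2f\,\eta\wedge\Phi+2\,\omega\wedge\Phi .$$ Theorem. (1) $(M,\phi,\xi,\eta,g)$ is locally conformal almost generalized $f$-cosymplectic if and only if there is a globally defined Lee form on $M$. (2) If $n\ge 1$ and $(U_t,\sigma_t)_{t\in I}$ realizes the locally conformal property, then the local differentials $d\sigma_t$ glue to a Lee form: there is a Lee form $\omega$ on $M$ with $\omega|_{U_t}=d\sigma_t$ for all $t\in I$. (3) Conversely, for every Lee form $\omega$ on $M$ there is a family $(U_t,\sigma_t)_{t\in I}$ that realizes the locally conformal property and satisfies $\omega|_{U_t}=d\sigma_t$ for all $t\in I$. -/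

import Mathlib

open Set
open scoped Manifold ContDiff Bundle

universe u v

namespace ACM

noncomputable section

/-- The wedge product `α ∧ β` of a covector with an alternating `k`-form, in the normalization
`(α ∧ β)(v₀, …, v_k) = ∑ i, (-1) ^ i α(v_i) β(v₀, …, v_{i-1}, v_{i+1}, …, v_k)`, the one that
matches the exterior derivative `extDeriv`. -/
def wedge {V : Type*} [NormedAddCommGroup V] [NormedSpace ℝ V] {k : ℕ}
    (α : V →L[ℝ] ℝ) (β : V [⋀^Fin k]→L[ℝ] ℝ) : V [⋀^Fin (k + 1)]→L[ℝ] ℝ :=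
  .alternatizeUncurryFin (α.smulRight β)

theorem wedge_apply {V : Type*} [NormedAddCommGroup V] [NormedSpace ℝ V] {k : ℕ}
    (α : V →L[ℝ] ℝ) (β : V [⋀^Fin k]→L[ℝ] ℝ) (v : Fin (k + 1) → V) :
    wedge α β v = ∑ i, (-1 : ℤ) ^ i.val • (α (v i) * β (i.removeNth v)) := by
  simp [wedge, ContinuousAlternatingMap.alternatizeUncurryFin_apply]

variable {m : ℕ} {M : Type*} [TopologicalSpace M] [ChartedSpace (EuclideanSpace ℝ (Fin m)) M]

/-- A covector as an alternating form of degree one. -/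
def form1 {x : M} (α : TangentSpace (𝓡 m) x →L[ℝ] ℝ) :
    TangentSpace (𝓡 m) x [⋀^Fin 1]→L[ℝ] ℝ :=
  ContinuousAlternatingMap.ofSubsingleton ℝ (TangentSpace (𝓡 m) x) ℝ (0 : Fin 1) α

/-- A field of alternating `k`-forms on the `m`-manifold `M` (no regularity required), read in the
preferred chart at `x`: its pullback under the inverse of this chart. -/
def chartForm {k : ℕ} (θ : ∀ x : M, TangentSpace (𝓡 m) x [⋀^Fin k]→L[ℝ] ℝ) (x : M) :
    EuclideanSpace ℝ (Fin m) → EuclideanSpace ℝ (Fin m) [⋀^Fin k]→L[ℝ] ℝ :=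
  fun y ↦ (θ ((extChartAt (𝓡 m) x).symm y)).compContinuousLinearMap
    (mfderiv 𝓘(ℝ, EuclideanSpace ℝ (Fin m)) (𝓡 m) (extChartAt (𝓡 m) x).symm y)

/-- The exterior derivative on the manifold `M`: at `x` it is computed in the chart at `x` and
pulled back to the tangent space. -/
def extD {k : ℕ} (θ : ∀ x : M, TangentSpace (𝓡 m) x [⋀^Fin k]→L[ℝ] ℝ) (x : M) :
    TangentSpace (𝓡 m) x [⋀^Fin (k + 1)]→L[ℝ] ℝ :=
  ContinuousAlternatingMap.compContinuousLinearMap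
    (extDeriv (chartForm θ x) (extChartAt (𝓡 m) x x))
    (mfderiv (𝓡 m) 𝓘(ℝ, EuclideanSpace ℝ (Fin m)) (extChartAt (𝓡 m) x) x)

/-- The differential of a real function on `M`, as a field of covectors. -/
def diff (σ : M → ℝ) (x : M) : TangentSpace (𝓡 m) x →L[ℝ] ℝ :=
  mfderiv (𝓡 m) 𝓘(ℝ, ℝ) σ x

/-- Smoothness of a field of covectors on a set, as a section of the cotangent bundle. -/
def SmoothCovectorOn [IsManifold (𝓡 m) ∞ M]
    (α : ∀ x : M, TangentSpace (𝓡 m) x →L[ℝ] ℝ) (U : Set M) : Prop :=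
  ContMDiffOn (𝓡 m) ((𝓡 m).prod 𝓘(ℝ, EuclideanSpace ℝ (Fin m) →L[ℝ] ℝ)) ∞
    (fun x ↦ Bundle.TotalSpace.mk' (EuclideanSpace ℝ (Fin m) →L[ℝ] ℝ)
      (E := fun x : M ↦ TangentSpace (𝓡 m) x →L[ℝ] Bundle.Trivial M ℝ x) x (α x)) U

/-- The pointwise data `(φ, ξ, η, g)` and the pointwise identities of an almost contact metric
structure. No regularity is required here: see `AlmostContactMetric.SmoothOn`. -/
structure AlmostContactMetric (m : ℕ) (M : Type*) [TopologicalSpace M]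
    [ChartedSpace (EuclideanSpace ℝ (Fin m)) M] where
  /-- the field of endomorphisms -/
  φ : ∀ x : M, TangentSpace (𝓡 m) x →L[ℝ] TangentSpace (𝓡 m) x
  /-- the Reeb vector field -/
  ξ : ∀ x : M, TangentSpace (𝓡 m) x
  /-- the contact form -/
  η : ∀ x : M, TangentSpace (𝓡 m) x →L[ℝ] ℝ
  /-- the metric -/
  g : ∀ x : M, TangentSpace (𝓡 m) x →L[ℝ] TangentSpace (𝓡 m) x →L[ℝ] ℝ
  g_symm : ∀ x v w, g x v w = g x w v
  g_pos : ∀ x v, v ≠ 0 → 0 < g x v v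
  φ_sq : ∀ x v, φ x (φ x v) = -v + η x v • ξ x
  η_ξ : ∀ x, η x (ξ x) = 1
  g_φ : ∀ x v w, g x (φ x v) (φ x w) = g x v w - η x v * η x w

namespace AlmostContactMetric

variable (S : AlmostContactMetric m M)

/-- `φ, ξ, η, g` are smooth tensor fields on `U`. -/
structure SmoothOn [IsManifold (𝓡 m) ∞ M] (U : Set M) : Prop where
  φ : ContMDiffOn (𝓡 m)
    ((𝓡 m).prod 𝓘(ℝ, EuclideanSpace ℝ (Fin m) →L[ℝ] EuclideanSpace ℝ (Fin m))) ∞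
    (fun x ↦ Bundle.TotalSpace.mk' (EuclideanSpace ℝ (Fin m) →L[ℝ] EuclideanSpace ℝ (Fin m))
      (E := fun x : M ↦ TangentSpace (𝓡 m) x →L[ℝ] TangentSpace (𝓡 m) x) x (S.φ x)) U
  ξ : ContMDiffOn (𝓡 m) ((𝓡 m).prod 𝓘(ℝ, EuclideanSpace ℝ (Fin m))) ∞
    (fun x ↦ Bundle.TotalSpace.mk' (EuclideanSpace ℝ (Fin m))
      (E := fun x : M ↦ TangentSpace (𝓡 m) x) x (S.ξ x)) U
  η : SmoothCovectorOn S.η U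
  g : ContMDiffOn (𝓡 m)
    ((𝓡 m).prod 𝓘(ℝ, EuclideanSpace ℝ (Fin m) →L[ℝ] EuclideanSpace ℝ (Fin m) →L[ℝ] ℝ)) ∞
    (fun x ↦ Bundle.TotalSpace.mk'
      (EuclideanSpace ℝ (Fin m) →L[ℝ] EuclideanSpace ℝ (Fin m) →L[ℝ] ℝ)
      (E := fun x : M ↦
        TangentSpace (𝓡 m) x →L[ℝ] TangentSpace (𝓡 m) x →L[ℝ] Bundle.Trivial M ℝ x) x (S.g x)) U

theorem φ_ξ (x : M) : S.φ x (S.ξ x) = 0 := by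
  have hξ : S.ξ x ≠ 0 := fun h ↦ by simpa [h] using S.η_ξ x
  have h0 : S.φ x (S.φ x (S.ξ x)) = 0 := by rw [S.φ_sq, S.η_ξ]; simp
  have h1 : S.φ x (S.ξ x) = S.η x (S.φ x (S.ξ x)) • S.ξ x := by
    have h := S.φ_sq x (S.φ x (S.ξ x))
    rw [h0, map_zero] at h
    exact neg_add_eq_zero.mp h.symm
  generalize S.η x (S.φ x (S.ξ x)) = c at h1
  rw [h1, map_smul, h1, smul_smul] at h0
  have hc : c = 0 := by simpa using (smul_eq_zero.mp h0).resolve_right hξ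
  rw [h1, hc, zero_smul]

theorem η_φ (x : M) (v : TangentSpace (𝓡 m) x) : S.η x (S.φ x v) = 0 := by
  have hξ : S.ξ x ≠ 0 := fun h ↦ by simpa [h] using S.η_ξ x
  have h3 := S.φ_sq x (S.φ x v)
  rw [S.φ_sq x v, map_add, map_neg, map_smul, φ_ξ, smul_zero, add_zero] at h3
  exact (smul_eq_zero.mp (left_eq_add.mp h3)).resolve_right hξ

theorem g_φ_self (x : M) (v : TangentSpace (𝓡 m) x) : S.g x v (S.φ x v) = 0 := by
  have h1 := S.g_φ x v (S.φ x v)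
  have h2 := S.g_φ x (S.φ x v) (S.ξ x)
  rw [φ_ξ, map_zero, η_φ, zero_mul, sub_zero] at h2
  rw [η_φ, mul_zero, sub_zero, S.φ_sq, map_add, map_neg, map_smul, ← h2, smul_zero, add_zero,
    S.g_symm x (S.φ x v) v] at h1
  linarith

/-- The second fundamental form `Φ(v, w) = g(v, φ w)`. -/
def Φ (x : M) : TangentSpace (𝓡 m) x [⋀^Fin 2]→L[ℝ] ℝ where
  toFun v := S.g x (v 0) (S.φ x (v 1))
  map_update_add' v i a b := by fin_cases i <;> simp
  map_update_smul' v i c a := by fin_cases i <;> simp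
  map_eq_zero_of_eq' v i j h hij := by
    have h01 : v 0 = v 1 := by
      fin_cases i <;> fin_cases j <;> first | exact absurd rfl hij | exact h | exact h.symm
    rw [h01]
    exact S.g_φ_self x (v 1)
  cont := by
    have key : ∀ (G : EuclideanSpace ℝ (Fin m) →L[ℝ] EuclideanSpace ℝ (Fin m) →L[ℝ] ℝ)
        (F : EuclideanSpace ℝ (Fin m) →L[ℝ] EuclideanSpace ℝ (Fin m)),
        Continuous fun v : Fin 2 → EuclideanSpace ℝ (Fin m) ↦ G (v 0) (F (v 1)) := by
      intro G F
      fun_prop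
    exact key (S.g x) (S.φ x)

/-- The conformally rescaled structure `(φ, e^σ ξ, e^{-σ} η, e^{-2σ} g)`. -/
def rescale (σ : M → ℝ) : AlmostContactMetric m M where
  φ := S.φ
  ξ x := Real.exp (σ x) • S.ξ x
  η x := Real.exp (-σ x) • S.η x
  g x := Real.exp (-2 * σ x) • S.g x
  g_symm x v w := by simp [S.g_symm x v w]
  g_pos x v hv := by simpa using mul_pos (Real.exp_pos _) (S.g_pos x v hv)
  φ_sq x v := by
    have h : Real.exp (-σ x) * Real.exp (σ x) = 1 := by rw [← Real.exp_add]; simp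
    rw [S.φ_sq, smul_smul, _root_.smul_apply, smul_eq_mul, mul_right_comm, h, one_mul]
  η_ξ x := by
    have h : Real.exp (-σ x) * Real.exp (σ x) = 1 := by rw [← Real.exp_add]; simp
    simp [S.η_ξ, h, mul_comm (Real.exp (σ x))]
  g_φ x v w := by
    have h : Real.exp (-2 * σ x) = Real.exp (-σ x) * Real.exp (-σ x) := by
      rw [← Real.exp_add]; ring_nf
    simp only [_root_.smul_apply, smul_eq_mul, S.g_φ, h]
    ring

/-- On the open set `U`, the structure is a smooth almost contact metric structure which is almost
generalized `f`-cosymplectic: `f` is smooth, `dη = 0` and `dΦ = 2 f η ∧ Φ`. -/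
structure IsCosymplecticOn [IsManifold (𝓡 m) ∞ M] (f : M → ℝ) (U : Set M) : Prop where
  smooth : S.SmoothOn U
  smooth_f : ContMDiffOn (𝓡 m) 𝓘(ℝ, ℝ) ∞ f U
  d_η : ∀ x ∈ U, extD (fun y ↦ form1 (S.η y)) x = 0
  d_Φ : ∀ x ∈ U, extD S.Φ x =
    (2 * f x) • wedge (V := EuclideanSpace ℝ (Fin m)) (S.η x) (S.Φ x)

/-- `(U t, σ t)` is an open covering of `M` with smooth functions `σ t` on `U t` such that, on each
`U t`, the structure rescaled by `σ t` is almost generalized `f e^{σ t}`-cosymplectic. (The values of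
`σ t` outside `U t` are irrelevant.) -/
structure IsLocalConformalData [IsManifold (𝓡 m) ∞ M] (f : M → ℝ) {ι : Type*}
    (U : ι → Set M) (σ : ι → M → ℝ) : Prop where
  isOpen : ∀ t, IsOpen (U t)
  cover : ⋃ t, U t = univ
  smooth : ∀ t, ContMDiffOn (𝓡 m) 𝓘(ℝ, ℝ) ∞ (σ t) (U t)
  cosymplectic : ∀ t,
    (S.rescale (σ t)).IsCosymplecticOn (fun x ↦ f x * Real.exp (σ t x)) (U t)

/-- `S` is locally conformal almost generalized `f`-cosymplectic. -/
def IsLocallyConformal {M : Type u} [TopologicalSpace M]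
    [ChartedSpace (EuclideanSpace ℝ (Fin m)) M] [IsManifold (𝓡 m) ∞ M]
    (S : AlmostContactMetric m M) (f : M → ℝ) : Prop :=
  ∃ (ι : Type u) (U : ι → Set M) (σ : ι → M → ℝ), S.IsLocalConformalData f U σ

/-- `lee` is a smooth closed `1`-form on `M` with `dη = lee ∧ η` and `dΦ = 2 f η ∧ Φ + 2 lee ∧ Φ`. -/
structure IsLeeForm [IsManifold (𝓡 m) ∞ M] (f : M → ℝ)
    (lee : ∀ x : M, TangentSpace (𝓡 m) x →L[ℝ] ℝ) : Prop where
  smooth : SmoothCovectorOn lee univ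
  closed : ∀ x, extD (fun y ↦ form1 (lee y)) x = 0
  d_η : ∀ x, extD (fun y ↦ form1 (S.η y)) x =
    wedge (V := EuclideanSpace ℝ (Fin m)) (lee x) (form1 (S.η x))
  d_Φ : ∀ x, extD S.Φ x =
    (2 * f x) • wedge (V := EuclideanSpace ℝ (Fin m)) (S.η x) (S.Φ x) +
      (2 : ℝ) • wedge (V := EuclideanSpace ℝ (Fin m)) (lee x) (S.Φ x)

end AlmostContactMetric

end

end ACM

/-!
For a smooth function `σ`, the Leibniz rule gives
`d(e^{-σ} η) = e^{-σ} (dη - dσ ∧ η)` and `d(e^{-2σ} Φ) = e^{-2σ} (dΦ - 2 dσ ∧ Φ)`, and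
`e^{-2σ} Φ` is the second fundamental form of the structure rescaled by `σ`. So the rescaled structure
is almost generalized `f e^σ`-cosymplectic exactly where `dη = dσ ∧ η` and
`dΦ = 2 f η ∧ Φ + 2 dσ ∧ Φ` (`extD_rescale_η_eq_zero_iff`, `extD_rescale_Φ_eq_iff`): exactly where
`dσ` satisfies the two Lee equations.

In dimension at least three these equations determine a covector: if `γ ∧ η = 0` and `γ ∧ Φ = 0`,
then `γ = γ(ξ) η`, and evaluating `γ ∧ Φ` on `(ξ, v, φ v)` for some `v ≠ 0` in the kernel of `η` gives
`-γ(ξ) g(v, v) = 0` (`covector_ext_of_wedge`). Hence the local differentials `dσ_t` agree on overlaps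
and glue to a Lee form (`IsLocalConformalData.exists_leeForm`). In dimension one all forms of degree
at least two vanish, and the zero form is a Lee form.

Conversely a Lee form is closed, so it has local primitives by the Poincaré lemma on a ball in a chart
(`exists_local_primitive`), and these primitives are the conformal factors sought
(`IsLeeForm.exists_localConformalData`). Since `extD` is computed at each point in the preferred chart
of that point, this needs the exterior derivative to be the same in all charts (`extD_eq_pullback`),
which follows from the naturality of `extDeriv` under transition maps.
-/

namespace ACM

open Filter
open scoped Topology

noncomputable section

/-! ### Multilinear algebra -/

section Algebra

variable {V : Type*} [NormedAddCommGroup V] [NormedSpace ℝ V] {k : ℕ}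

theorem wedge_smul_left (c : ℝ) (α : V →L[ℝ] ℝ) (β : V [⋀^Fin k]→L[ℝ] ℝ) :
    wedge (c • α) β = c • wedge α β := by
  ext v
  simp [wedge_apply, Finset.mul_sum, mul_assoc, mul_left_comm c]

theorem wedge_smul_right (c : ℝ) (α : V →L[ℝ] ℝ) (β : V [⋀^Fin k]→L[ℝ] ℝ) :
    wedge α (c • β) = c • wedge α β := by
  ext v
  simp [wedge_apply, Finset.mul_sum, mul_left_comm c]

/-- There are no nonzero alternating forms of degree larger than the dimension. -/
theorem alternating_eq_zero_of_finrank_lt [FiniteDimensional ℝ V]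
    (h : Module.finrank ℝ V < k) (β : V [⋀^Fin k]→L[ℝ] ℝ) : β = 0 := by
  ext v
  refine β.toAlternatingMap.map_linearDependent v fun hv ↦ ?_
  have := hv.fintype_card_le_finrank
  simp at this
  omega

/-- The alternating part `(v, w) ↦ (B(v, w) - B(w, v)) / 2` of a bilinear form `B`. It fixes bilinear
forms that are already alternating, which transfers differentiability of a field of bilinear forms to
the corresponding field of alternating forms. -/
def bilinToForm (V : Type*) [NormedAddCommGroup V] [NormedSpace ℝ V] :
    (V →L[ℝ] V →L[ℝ] ℝ) →L[ℝ] V [⋀^Fin 2]→L[ℝ] ℝ :=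
  (1 / 2 : ℝ) • (ContinuousAlternatingMap.alternatizeUncurryFinCLM ℝ V ℝ).comp
    (ContinuousLinearMap.compL ℝ V (V →L[ℝ] ℝ) (V [⋀^Fin 1]→L[ℝ] ℝ)
      (ContinuousAlternatingMap.ofSubsingletonLIE (𝕜 := ℝ) (E := V) (F := ℝ) (0 : Fin 1) :
        (V →L[ℝ] ℝ) →L[ℝ] V [⋀^Fin 1]→L[ℝ] ℝ))

theorem bilinToForm_apply (B : V →L[ℝ] V →L[ℝ] ℝ) (v : Fin 2 → V) :
    bilinToForm V B v = (1 / 2 : ℝ) * (B (v 0) (v 1) - B (v 1) (v 0)) := by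
  simp [bilinToForm, ContinuousAlternatingMap.alternatizeUncurryFin_apply, Fin.sum_univ_two,
    Fin.removeNth, sub_eq_add_neg]

/-- Precomposition `F ↦ (α ↦ α ∘ F)` with an endomorphism, as a continuous linear map in `F`. -/
def precompCLM (V : Type*) [NormedAddCommGroup V] [NormedSpace ℝ V] :
    (V →L[ℝ] V) →L[ℝ] (V →L[ℝ] ℝ) →L[ℝ] V →L[ℝ] ℝ :=
  (ContinuousLinearMap.compL ℝ V V ℝ).flip

theorem differentiableAt_clm_comp {A B C : Type*} [NormedAddCommGroup A] [NormedSpace ℝ A]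
    [NormedAddCommGroup B] [NormedSpace ℝ B] [NormedAddCommGroup C] [NormedSpace ℝ C]
    (L : A →L[ℝ] B) {F : C → A} {y : C} (hF : DifferentiableAt ℝ F y) :
    DifferentiableAt ℝ (fun z ↦ L (F z)) y :=
  L.differentiableAt.comp y hF

set_option synthInstance.maxHeartbeats 200000 in
theorem differentiableAt_bilinToForm_comp {F : V → V →L[ℝ] V} {G : V → V →L[ℝ] V →L[ℝ] ℝ} {y : V}
    (hF : DifferentiableAt ℝ F y) (hG : DifferentiableAt ℝ G y) :
    DifferentiableAt ℝ (fun z ↦ bilinToForm V ((precompCLM V (F z)).comp (G z))) y := by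
  have h : DifferentiableAt ℝ (fun z ↦ precompCLM V (F z)) y :=
    differentiableAt_clm_comp (A := V →L[ℝ] V) (B := (V →L[ℝ] ℝ) →L[ℝ] V →L[ℝ] ℝ)
      (precompCLM V) hF
  exact differentiableAt_clm_comp (A := V →L[ℝ] V →L[ℝ] ℝ) (bilinToForm V) (h.clm_comp hG)

/-- Let `v, w` lie in the kernel of `η` and let `Ω(v, w) ≠ 0`. Then a covector `γ` is determined by
`γ ∧ η` and `γ ∧ Ω`: the first determines it up to a multiple of `η`, and `(γ ∧ Ω)(ξ, v, w)` determines
that multiple. -/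
theorem covector_eq_of_wedge_eq {V : Type*} [NormedAddCommGroup V] [NormedSpace ℝ V]
    {α β η : V →L[ℝ] ℝ} {Ω : V [⋀^Fin 2]→L[ℝ] ℝ} {ξ v w : V} (hξ : η ξ = 1) (hv : η v = 0)
    (hw : η w = 0) (hΩ : Ω ![v, w] ≠ 0)
    (h1 : wedge α (ContinuousAlternatingMap.ofSubsingleton ℝ V ℝ (0 : Fin 1) η) =
      wedge β (ContinuousAlternatingMap.ofSubsingleton ℝ V ℝ (0 : Fin 1) η))
    (h2 : wedge α Ω = wedge β Ω) : α = β := by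
  have key : ∀ u, α u - β u = (α ξ - β ξ) * η u := by
    intro u
    have h := DFunLike.congr_fun h1 ![ξ, u]
    simp [wedge_apply, Fin.sum_univ_two, Fin.removeNth, hξ] at h
    linarith
  have hαβ : α ξ - β ξ = 0 := by
    have h := DFunLike.congr_fun h2 ![ξ, v, w]
    have e : (0 : Fin 3).removeNth ![ξ, v, w] = ![v, w] := rfl
    have a1 : α v = β v := by linarith [key v, mul_eq_zero_of_right (α ξ - β ξ) hv]
    have a2 : α w = β w := by linarith [key w, mul_eq_zero_of_right (α ξ - β ξ) hw]
    rw [wedge_apply, wedge_apply, Fin.sum_univ_three, Fin.sum_univ_three, e] at h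
    simp [a1, a2] at h
    exact sub_eq_zero.2 (h.resolve_right hΩ)
  ext u
  rw [← sub_eq_zero, key u, hαβ, zero_mul]

end Algebra

/-! ### The exterior derivative in charts -/

variable {m : ℕ} {M : Type*} [TopologicalSpace M] [ChartedSpace (EuclideanSpace ℝ (Fin m)) M]

/-- A field of covectors read in the preferred chart at `x`. This is `chartForm` in degree one, with
values in the dual space instead of the space of alternating forms; see `chartForm_form1`. -/
def chartCov (α : ∀ x : M, TangentSpace (𝓡 m) x →L[ℝ] ℝ) (x : M) :
    EuclideanSpace ℝ (Fin m) → EuclideanSpace ℝ (Fin m) →L[ℝ] ℝ :=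
  fun y ↦ (α ((extChartAt (𝓡 m) x).symm y)).comp
    (mfderiv 𝓘(ℝ, EuclideanSpace ℝ (Fin m)) (𝓡 m) (extChartAt (𝓡 m) x).symm y)

theorem chartForm_form1 (α : ∀ x : M, TangentSpace (𝓡 m) x →L[ℝ] ℝ) (x : M)
    (y : EuclideanSpace ℝ (Fin m)) :
    chartForm (fun z ↦ form1 (α z)) x y =
      ContinuousAlternatingMap.ofSubsingleton ℝ (EuclideanSpace ℝ (Fin m)) ℝ (0 : Fin 1)
        (chartCov α x y) := by
  ext v
  rfl

theorem contMDiffAt_iff_contDiffAt_chart {G : Type*} [NormedAddCommGroup G] [NormedSpace ℝ G]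
    [IsManifold (𝓡 m) ∞ M] {F : M → G} {x : M} :
    ContMDiffAt (𝓡 m) 𝓘(ℝ, G) ∞ F x ↔
      ContDiffAt ℝ ∞ (F ∘ (extChartAt (𝓡 m) x).symm) (extChartAt (𝓡 m) x x) := by
  rw [contMDiffAt_iff_source_of_mem_source (x := x) (mem_chart_source _ x)]
  simp [contMDiffAt_iff_contDiffAt, contMDiffWithinAt_univ]

/-- The tangent space at `x` is identified with the model space through the preferred chart at `x`, so
the derivative of this chart at `x` is the identity. -/
theorem mfderiv_extChartAt_self_eq_id [IsManifold (𝓡 m) ∞ M] (x : M) :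
    mfderiv (𝓡 m) 𝓘(ℝ, EuclideanSpace ℝ (Fin m)) (extChartAt (𝓡 m) x) x =
      ContinuousLinearMap.id ℝ (EuclideanSpace ℝ (Fin m)) :=
  mfderiv_extChartAt_self

theorem mfderiv_extChartAt_symm_self [IsManifold (𝓡 m) ∞ M] (x : M) :
    mfderiv 𝓘(ℝ, EuclideanSpace ℝ (Fin m)) (𝓡 m) (extChartAt (𝓡 m) x).symm
      (extChartAt (𝓡 m) x x) = ContinuousLinearMap.id ℝ (EuclideanSpace ℝ (Fin m)) := by
  have := mfderivWithin_range_extChartAt_symm (I := 𝓡 m) (x := x)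
  rw [ModelWithCorners.range_eq_univ, mfderivWithin_univ] at this
  exact this

/-- At `x` the pullback in the definition of `extD` is along the identity and can be dropped. -/
theorem extD_eq_extDeriv [IsManifold (𝓡 m) ∞ M] {k : ℕ}
    (θ : ∀ x : M, TangentSpace (𝓡 m) x [⋀^Fin k]→L[ℝ] ℝ) (x : M) :
    extD θ x = extDeriv (chartForm θ x) (extChartAt (𝓡 m) x x) := by
  ext v
  rw [extD, mfderiv_extChartAt_self_eq_id]
  rfl

theorem chartForm_self [IsManifold (𝓡 m) ∞ M] {k : ℕ}
    (θ : ∀ x : M, TangentSpace (𝓡 m) x [⋀^Fin k]→L[ℝ] ℝ) (x : M) :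
    chartForm θ x (extChartAt (𝓡 m) x x) = θ x := by
  rw [chartForm, mfderiv_extChartAt_symm_self]
  rw [extChartAt_to_inv]
  rfl

theorem eventually_extChartAt_symm {P : M → Prop} {x : M} (h : ∀ᶠ z in 𝓝 x, P z) :
    ∀ᶠ y in 𝓝 (extChartAt (𝓡 m) x x), P ((extChartAt (𝓡 m) x).symm y) := by
  have := continuousAt_extChartAt_symm (I := 𝓡 m) x
  rw [ContinuousAt, extChartAt_to_inv] at this
  exact this.eventually h

theorem chartForm_congr {k : ℕ}
    {θ θ' : ∀ x : M, TangentSpace (𝓡 m) x [⋀^Fin k]→L[ℝ] ℝ} {x : M}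
    (h : ∀ᶠ z in 𝓝 x, θ z = θ' z) :
    chartForm θ x =ᶠ[𝓝 (extChartAt (𝓡 m) x x)] chartForm θ' x := by
  filter_upwards [eventually_extChartAt_symm h] with y hy
  rw [chartForm, chartForm, hy]

theorem extD_congr {k : ℕ}
    {θ θ' : ∀ x : M, TangentSpace (𝓡 m) x [⋀^Fin k]→L[ℝ] ℝ} {x : M}
    (h : ∀ᶠ z in 𝓝 x, θ z = θ' z) : extD θ x = extD θ' x := by
  rw [extD, extD, (chartForm_congr h).extDeriv_eq]

theorem extChartAt_symm_mem_source {x : M} {y : EuclideanSpace ℝ (Fin m)}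
    (hy : y ∈ (extChartAt (𝓡 m) x).target) :
    (extChartAt (𝓡 m) x).symm y ∈ (chartAt (EuclideanSpace ℝ (Fin m)) x).source := by
  simpa using (extChartAt (𝓡 m) x).map_target hy

theorem mdifferentiableAt_extChartAt_symm_of_mem [IsManifold (𝓡 m) ∞ M] {x : M}
    {y : EuclideanSpace ℝ (Fin m)} (hy : y ∈ (extChartAt (𝓡 m) x).target) :
    MDifferentiableAt 𝓘(ℝ, EuclideanSpace ℝ (Fin m)) (𝓡 m) (extChartAt (𝓡 m) x).symm y := by
  have := mdifferentiableWithinAt_extChartAt_symm (I := 𝓡 m) (x := x) hy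
  rwa [ModelWithCorners.range_eq_univ, mdifferentiableWithinAt_univ] at this

theorem extDeriv_fun_smul_field {E : Type*} [NormedAddCommGroup E] [NormedSpace ℝ E] {k : ℕ}
    {a : E → ℝ} {a' : E →L[ℝ] ℝ} {θ : E → E [⋀^Fin k]→L[ℝ] ℝ} {y : E} (ha : HasFDerivAt a a' y)
    (hθ : DifferentiableAt ℝ θ y) :
    extDeriv (fun z ↦ a z • θ z) y = a y • extDeriv θ y + wedge a' (θ y) := by
  rw [extDeriv, fderiv_fun_smul ha.differentiableAt hθ,
    ContinuousAlternatingMap.alternatizeUncurryFin_add,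
    ContinuousAlternatingMap.alternatizeUncurryFin_smul, ha.fderiv]
  rfl

/-- The differential at `x` is the derivative in the preferred chart at `x`. The type of the source is
given because `diff a x` is a map on the tangent space, which is only definitionally the model space. -/
theorem hasFDerivAt_comp_chart_symm [IsManifold (𝓡 m) ∞ M] {a : M → ℝ} {x : M}
    (ha : MDifferentiableAt (𝓡 m) 𝓘(ℝ, ℝ) a x) :
    HasFDerivAt (E := EuclideanSpace ℝ (Fin m)) (a ∘ (extChartAt (𝓡 m) x).symm) (diff a x)
      (extChartAt (𝓡 m) x x) := by
  have h1 := mdifferentiableAt_extChartAt_symm_of_mem (mem_extChartAt_target (I := 𝓡 m) x)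
  have ha' := ha
  rw [← extChartAt_to_inv (I := 𝓡 m) x] at ha'
  have h3 := (ha'.comp _ h1).differentiableAt.hasFDerivAt
  rw [← mfderiv_eq_fderiv, mfderiv_comp _ ha' h1, mfderiv_extChartAt_symm_self] at h3
  rw [extChartAt_to_inv] at h3
  exact h3

/-- The Leibniz rule `d(a θ) = a dθ + da ∧ θ`. The value of `dθ` is a variable `d`, so that the sum is
formed in the alternating forms on the model space, as in the definition of a Lee form. -/
theorem extD_smul [IsManifold (𝓡 m) ∞ M] {k : ℕ} {a : M → ℝ}
    {θ : ∀ x : M, TangentSpace (𝓡 m) x [⋀^Fin k]→L[ℝ] ℝ} {x : M}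
    {d : EuclideanSpace ℝ (Fin m) [⋀^Fin (k + 1)]→L[ℝ] ℝ} (hd : extD θ x = d)
    (ha : MDifferentiableAt (𝓡 m) 𝓘(ℝ, ℝ) a x)
    (hθ : DifferentiableAt ℝ (chartForm θ x) (extChartAt (𝓡 m) x x)) :
    extD (fun z ↦ a z • θ z) x =
      a x • d + wedge (V := EuclideanSpace ℝ (Fin m)) (diff a x) (θ x) := by
  have h3 : chartForm (fun z ↦ a z • θ z) x =
      fun y ↦ (a ∘ (extChartAt (𝓡 m) x).symm) y • chartForm θ x y := rfl
  rw [extD_eq_extDeriv] at hd ⊢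
  rw [h3, extDeriv_fun_smul_field (hasFDerivAt_comp_chart_symm ha) hθ, hd, chartForm_self,
    Function.comp_apply, extChartAt_to_inv]

theorem hasFDerivAt_chartCov_diff [IsManifold (𝓡 m) ∞ M] {σ : M → ℝ} {x : M}
    {y : EuclideanSpace ℝ (Fin m)}
    (hy : y ∈ (extChartAt (𝓡 m) x).target)
    (hσ : MDifferentiableAt (𝓡 m) 𝓘(ℝ, ℝ) σ ((extChartAt (𝓡 m) x).symm y)) :
    HasFDerivAt (σ ∘ (extChartAt (𝓡 m) x).symm) (chartCov (diff σ) x y) y := by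
  have h1 := mdifferentiableAt_extChartAt_symm_of_mem hy
  have h2 := hσ.comp _ h1
  have h3 := h2.differentiableAt.hasFDerivAt
  rw [← mfderiv_eq_fderiv, mfderiv_comp _ hσ h1] at h3
  exact h3

theorem minSmoothness_two_le_infty : minSmoothness ℝ 2 ≤ (∞ : ℕ∞ω) := by
  rw [minSmoothness_of_isRCLikeNormedField]
  exact WithTop.coe_le_coe.2 le_top

/-- Smoothness at a point in the `C^∞` sense gives no common neighbourhood for all orders, but it gives
one for first-order differentiability. -/
theorem eventually_mdifferentiableAt [IsManifold (𝓡 m) ∞ M] {σ : M → ℝ} {x : M}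
    (hσ : ContMDiffAt (𝓡 m) 𝓘(ℝ, ℝ) ∞ σ x) :
    ∀ᶠ z in 𝓝 x, MDifferentiableAt (𝓡 m) 𝓘(ℝ, ℝ) σ z := by
  have h : ContMDiffAt (𝓡 m) 𝓘(ℝ, ℝ) 1 σ x := hσ.of_le (by simp)
  have : IsManifold (𝓡 m) 1 M := .of_le (n := ∞) (by simp)
  filter_upwards [(contMDiffAt_iff_contMDiffAt_nhds (by simp)).1 h] with z hz
  exact hz.mdifferentiableAt one_ne_zero

/-- `d(dσ) = 0`. -/
theorem extD_diff [IsManifold (𝓡 m) ∞ M] {σ : M → ℝ} {x : M}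
    (hσ : ContMDiffAt (𝓡 m) 𝓘(ℝ, ℝ) ∞ σ x) : extD (fun y ↦ form1 (m := m) (diff σ y)) x = 0 := by
  rw [extD_eq_extDeriv]
  have h1 := eventually_mdifferentiableAt hσ
  have h2 : chartForm (fun y ↦ form1 (m := m) (diff σ y)) x =ᶠ[𝓝 (extChartAt (𝓡 m) x x)]
      extDeriv (fun y ↦ ContinuousAlternatingMap.constOfIsEmpty ℝ (EuclideanSpace ℝ (Fin m)) (Fin 0)
        ((σ ∘ (extChartAt (𝓡 m) x).symm) y)) := by
    filter_upwards [eventually_extChartAt_symm h1, extChartAt_target_mem_nhds (I := 𝓡 m) x]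
      with y hy hyt
    rw [chartForm_form1, extDeriv_constOfIsEmpty, (hasFDerivAt_chartCov_diff hyt hy).fderiv]
  rw [h2.extDeriv_eq]
  refine extDeriv_extDeriv_apply (r := ∞) ?_ minSmoothness_two_le_infty
  have h3 := contMDiffAt_iff_contDiffAt_chart.1 hσ
  exact (ContinuousAlternatingMap.constOfIsEmptyLIE ℝ (EuclideanSpace ℝ (Fin m)) ℝ
    (Fin 0)).contDiff.contDiffAt.comp _ h3

/-- A section of the cotangent bundle is smooth at `x` if and only if its expression in the preferred
chart at `x` is. -/
theorem smoothCovectorAt_iff [IsManifold (𝓡 m) ∞ M]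
    {α : ∀ x : M, TangentSpace (𝓡 m) x →L[ℝ] ℝ} {x : M} :
    ContMDiffAt (𝓡 m) ((𝓡 m).prod 𝓘(ℝ, EuclideanSpace ℝ (Fin m) →L[ℝ] ℝ)) ∞
      (fun x ↦ Bundle.TotalSpace.mk' (EuclideanSpace ℝ (Fin m) →L[ℝ] ℝ)
        (E := fun x : M ↦ TangentSpace (𝓡 m) x →L[ℝ] Bundle.Trivial M ℝ x) x (α x)) x ↔
    ContDiffAt ℝ ∞ (chartCov α x) (extChartAt (𝓡 m) x x) := by
  rw [contMDiffAt_hom_bundle, and_iff_right (by exact contMDiffAt_id),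
    contMDiffAt_iff_contDiffAt_chart]
  suffices h : _ =ᶠ[𝓝 (extChartAt (𝓡 m) x x)] chartCov α x from
    ⟨fun hc ↦ hc.congr_of_eventuallyEq h.symm, fun hc ↦ hc.congr_of_eventuallyEq h⟩
  filter_upwards [extChartAt_target_mem_nhds (I := 𝓡 m) x] with y hy
  have hs : (extChartAt (𝓡 m) x).symm y ∈ (chartAt (EuclideanSpace ℝ (Fin m)) x).source := by
    simpa using (extChartAt (𝓡 m) x).map_target hy
  have := TangentBundle.symmL_trivializationAt (I := 𝓡 m) hs
  rw [(extChartAt (𝓡 m) x).right_inv hy] at this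
  simp only [Function.comp_apply, ContinuousLinearMap.inCoordinates, this]
  ext v
  simp [chartCov]

theorem diff_exp_mul [IsManifold (𝓡 m) ∞ M] {σ : M → ℝ} {x : M} (c : ℝ)
    (hσ : MDifferentiableAt (𝓡 m) 𝓘(ℝ, ℝ) σ x) :
    MDifferentiableAt (𝓡 m) 𝓘(ℝ, ℝ) (fun z ↦ Real.exp (c * σ z)) x ∧
      diff (m := m) (fun z ↦ Real.exp (c * σ z)) x = (c * Real.exp (c * σ x)) • diff σ x := by
  have h1 : HasFDerivAt (fun t : ℝ ↦ Real.exp (c * t))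
      ((c * Real.exp (c * σ x)) • ContinuousLinearMap.id ℝ ℝ) (σ x) := by
    have : HasDerivAt (fun t : ℝ ↦ Real.exp (c * t)) (c * Real.exp (c * σ x)) (σ x) := by
      simpa [mul_comm] using ((hasDerivAt_id (σ x)).const_mul c).exp
    convert! this.hasFDerivAt using 1
    ext
    simp
  have h2 := HasMFDerivAt.comp x h1.hasMFDerivAt hσ.hasMFDerivAt
  exact ⟨h2.mdifferentiableAt, h2.mfderiv⟩

/-! ### Independence of the chart -/

theorem mfderiv_symm_comp_mfderiv [IsManifold (𝓡 m) ∞ M] {x p : M}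
    (hp : p ∈ (extChartAt (𝓡 m) x).source) (v : TangentSpace (𝓡 m) p) :
    mfderiv 𝓘(ℝ, EuclideanSpace ℝ (Fin m)) (𝓡 m) (extChartAt (𝓡 m) x).symm
      (extChartAt (𝓡 m) x p)
      (mfderiv (𝓡 m) 𝓘(ℝ, EuclideanSpace ℝ (Fin m)) (extChartAt (𝓡 m) x) p v) = v := by
  have := mfderivWithin_extChartAt_symm_comp_mfderiv_extChartAt' (I := 𝓡 m) hp
  rw [ModelWithCorners.range_eq_univ, mfderivWithin_univ] at this
  exact DFunLike.congr_fun this v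

theorem mfderiv_comp_mfderiv_symm [IsManifold (𝓡 m) ∞ M] {x : M} {y : EuclideanSpace ℝ (Fin m)}
    (hy : y ∈ (extChartAt (𝓡 m) x).target) (v : EuclideanSpace ℝ (Fin m)) :
    mfderiv (𝓡 m) 𝓘(ℝ, EuclideanSpace ℝ (Fin m)) (extChartAt (𝓡 m) x)
      ((extChartAt (𝓡 m) x).symm y)
      (mfderiv 𝓘(ℝ, EuclideanSpace ℝ (Fin m)) (𝓡 m) (extChartAt (𝓡 m) x).symm y v) = v := by
  have := mfderiv_extChartAt_comp_mfderivWithin_extChartAt_symm (I := 𝓡 m) hy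
  rw [ModelWithCorners.range_eq_univ, mfderivWithin_univ] at this
  exact DFunLike.congr_fun this v

theorem mdifferentiableAt_chart [IsManifold (𝓡 m) ∞ M] {x p : M}
    (hp : p ∈ (extChartAt (𝓡 m) x).source) :
    MDifferentiableAt (𝓡 m) 𝓘(ℝ, EuclideanSpace ℝ (Fin m)) (extChartAt (𝓡 m) x) p :=
  mdifferentiableAt_extChartAt (by simpa using hp)

/-- The exterior derivative at `p` can be computed in the preferred chart at any point `x` whose chart
domain contains `p`: on the domain of the transition map between the two charts, the two expressions
of `θ` differ by a pullback along this map. -/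
theorem extD_eq_pullback [IsManifold (𝓡 m) ∞ M] {k : ℕ}
    {θ : ∀ x : M, TangentSpace (𝓡 m) x [⋀^Fin k]→L[ℝ] ℝ} {x p : M}
    (hp : p ∈ (extChartAt (𝓡 m) x).source)
    (hθ : DifferentiableAt ℝ (chartForm θ x) (extChartAt (𝓡 m) x p)) :
    extD θ p = ContinuousAlternatingMap.compContinuousLinearMap
      (extDeriv (chartForm θ x) (extChartAt (𝓡 m) x p))
      (mfderiv (𝓡 m) 𝓘(ℝ, EuclideanSpace ℝ (Fin m)) (extChartAt (𝓡 m) x) p) := by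
  set τ : EuclideanSpace ℝ (Fin m) → EuclideanSpace ℝ (Fin m) :=
    extChartAt (𝓡 m) x ∘ (extChartAt (𝓡 m) p).symm
  have hτp : τ (extChartAt (𝓡 m) p p) = extChartAt (𝓡 m) x p := by simp [τ]
  have hsmooth : ContDiffAt ℝ ∞ τ (extChartAt (𝓡 m) p p) :=
    contMDiffAt_iff_contDiffAt_chart.1
      (contMDiffAt_extChartAt' (by simpa using hp))
  have hsrc : ∀ᶠ z in 𝓝 p, z ∈ (extChartAt (𝓡 m) x).source :=
    extChartAt_source_mem_nhds' hp
  have hτd : ∀ y ∈ (extChartAt (𝓡 m) p).target,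
      (extChartAt (𝓡 m) p).symm y ∈ (extChartAt (𝓡 m) x).source →
      ∀ w : EuclideanSpace ℝ (Fin m), fderiv ℝ τ y w =
        mfderiv (𝓡 m) 𝓘(ℝ, EuclideanSpace ℝ (Fin m)) (extChartAt (𝓡 m) x)
          ((extChartAt (𝓡 m) p).symm y) (mfderiv 𝓘(ℝ, EuclideanSpace ℝ (Fin m)) (𝓡 m)
            (extChartAt (𝓡 m) p).symm y w) := by
    intro y hy hys w
    rw [← mfderiv_eq_fderiv, mfderiv_comp _ (mdifferentiableAt_chart hys)
      (mdifferentiableAt_extChartAt_symm_of_mem hy)]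
    rfl
  have heq : chartForm θ p =ᶠ[𝓝 (extChartAt (𝓡 m) p p)]
      fun y ↦ (chartForm θ x (τ y)).compContinuousLinearMap (fderiv ℝ τ y) := by
    filter_upwards [eventually_extChartAt_symm hsrc, extChartAt_target_mem_nhds (I := 𝓡 m) p]
      with y hys hyt
    have hz : (extChartAt (𝓡 m) x).symm (τ y) = (extChartAt (𝓡 m) p).symm y := by
      simp only [τ, Function.comp_apply]
      exact (extChartAt (𝓡 m) x).left_inv hys
    ext v
    simp only [chartForm, ContinuousAlternatingMap.compContinuousLinearMap_apply]
    have key : ∀ w : EuclideanSpace ℝ (Fin m),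
        mfderiv 𝓘(ℝ, EuclideanSpace ℝ (Fin m)) (𝓡 m) (extChartAt (𝓡 m) x).symm (τ y)
          (fderiv ℝ τ y w) =
        mfderiv 𝓘(ℝ, EuclideanSpace ℝ (Fin m)) (𝓡 m) (extChartAt (𝓡 m) p).symm y w := by
      intro w
      rw [hτd y hyt hys w]
      exact mfderiv_symm_comp_mfderiv hys _
    -- The base points are equal only propositionally, so both arguments are transported at once.
    have hfun : ∀ z z' : M, z = z' → ∀ V V' : Fin k → EuclideanSpace ℝ (Fin m), V = V' →
        θ z V = θ z' V' := by
      rintro z _ rfl V _ rfl; rfl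
    exact hfun _ _ hz.symm _ _ (funext fun i ↦ (key (v i)).symm)
  have hlin : ∀ w : EuclideanSpace ℝ (Fin m), fderiv ℝ τ (extChartAt (𝓡 m) p p) w =
      mfderiv (𝓡 m) 𝓘(ℝ, EuclideanSpace ℝ (Fin m)) (extChartAt (𝓡 m) x) p w := by
    intro w
    rw [hτd _ (mem_extChartAt_target p) (by rwa [extChartAt_to_inv]) w,
      mfderiv_extChartAt_symm_self]
    rw [extChartAt_to_inv]
    rfl
  rw [extD_eq_extDeriv, heq.extDeriv_eq,
    extDeriv_pullback (r := ∞) (by rwa [hτp]) hsmooth minSmoothness_two_le_infty, hτp]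
  ext v
  exact congrArg (extDeriv (chartForm θ x) (extChartAt (𝓡 m) x p)) (funext fun i ↦ hlin (v i))

/-- A one-form is closed only if its derivative is a symmetric bilinear form. -/
theorem fderiv_symmetric_of_extDeriv_eq_zero {E : Type*} [NormedAddCommGroup E] [NormedSpace ℝ E]
    {β : E → E →L[ℝ] ℝ} {y : E} (hβ : DifferentiableAt ℝ β y)
    (h : extDeriv (fun z ↦ ContinuousAlternatingMap.ofSubsingleton ℝ E ℝ (0 : Fin 1) (β z)) y = 0)
    (u v : E) : fderiv ℝ β y u v = fderiv ℝ β y v u := by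
  have h1 : HasFDerivAt
      (fun z ↦ ContinuousAlternatingMap.ofSubsingleton ℝ E ℝ (0 : Fin 1) (β z))
      ((ContinuousAlternatingMap.ofSubsingletonLIE (𝕜 := ℝ) (E := E) (F := ℝ) (0 : Fin 1) :
        (E →L[ℝ] ℝ) →L[ℝ] E [⋀^Fin 1]→L[ℝ] ℝ).comp (fderiv ℝ β y)) y :=
    (ContinuousAlternatingMap.ofSubsingletonLIE (𝕜 := ℝ) (E := E) (F := ℝ) (0 : Fin 1) :
        (E →L[ℝ] ℝ) →L[ℝ] E [⋀^Fin 1]→L[ℝ] ℝ).hasFDerivAt.comp y hβ.hasFDerivAt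
  rw [extDeriv, h1.fderiv] at h
  have h2 := DFunLike.congr_fun h ![u, v]
  rw [ContinuousAlternatingMap.alternatizeUncurryFin_apply] at h2
  simp [Fin.sum_univ_two, Fin.removeNth] at h2
  linarith

/-! ### Local primitives of closed one-forms -/

/-- A function that is differentiable near `x` is smooth at `x` if and only if its differential is: in a
chart, the differential is the derivative of the function. -/
theorem smoothCovectorAt_diff_iff [IsManifold (𝓡 m) ∞ M] {σ : M → ℝ} {x : M}
    (hσ : ∀ᶠ z in 𝓝 x, MDifferentiableAt (𝓡 m) 𝓘(ℝ, ℝ) σ z) :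
    ContMDiffAt (𝓡 m) ((𝓡 m).prod 𝓘(ℝ, EuclideanSpace ℝ (Fin m) →L[ℝ] ℝ)) ∞
      (fun x ↦ Bundle.TotalSpace.mk' (EuclideanSpace ℝ (Fin m) →L[ℝ] ℝ)
        (E := fun x : M ↦ TangentSpace (𝓡 m) x →L[ℝ] Bundle.Trivial M ℝ x) x (diff σ x)) x ↔
    ContMDiffAt (𝓡 m) 𝓘(ℝ, ℝ) ∞ σ x := by
  rw [smoothCovectorAt_iff, contMDiffAt_iff_contDiffAt_chart]
  have hd : ∀ᶠ y in 𝓝 (extChartAt (𝓡 m) x x),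
      HasFDerivAt (σ ∘ (extChartAt (𝓡 m) x).symm) (chartCov (diff σ) x y) y := by
    filter_upwards [eventually_extChartAt_symm hσ, extChartAt_target_mem_nhds (I := 𝓡 m) x] with y h1 h2
    exact hasFDerivAt_chartCov_diff h2 h1
  constructor
  · intro h
    rw [contDiffAt_infty]
    intro n
    refine ContDiffAt.of_le (n := (n + 1 : ℕ)) ?_ (by exact_mod_cast Nat.le_succ n)
    refine contDiffAt_succ_iff_hasFDerivAt.2 ⟨_, ?_, h.of_le (by exact_mod_cast le_top)⟩
    exact eventually_iff_exists_mem.1 hd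
  · intro h
    refine ContDiffAt.congr_of_eventuallyEq (h.fderiv_right (m := ∞) (by simp)) ?_
    filter_upwards [hd] with y hy
    exact hy.fderiv.symm

/-- The Poincaré lemma: a smooth closed one-form is the differential of a function near every point. The
smoothness of this function is a consequence, by `smoothCovectorAt_diff_iff`. -/
theorem exists_local_primitive [IsManifold (𝓡 m) ∞ M]
    {α : ∀ x : M, TangentSpace (𝓡 m) x →L[ℝ] ℝ} (hα : SmoothCovectorOn α univ)
    (hd : ∀ x, extD (fun y ↦ form1 (α y)) x = 0) (x : M) :
    ∃ (U : Set M) (σ : M → ℝ), IsOpen U ∧ x ∈ U ∧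
      ∀ p ∈ U, MDifferentiableAt (𝓡 m) 𝓘(ℝ, ℝ) σ p ∧ diff σ p = α p := by
  have h1 : ContDiffAt ℝ 1 (chartCov α x) (extChartAt (𝓡 m) x x) :=
    (smoothCovectorAt_iff.1 ((hα x (mem_univ x)).contMDiffAt univ_mem)).of_le (by simp)
  obtain ⟨r, hr, hball⟩ := Metric.eventually_nhds_iff_ball.1
    ((h1.eventually (by simp)).and (extChartAt_target_mem_nhds (I := 𝓡 m) x))
  set B := Metric.ball (extChartAt (𝓡 m) x x) r
  have hdiff : ∀ z ∈ B, DifferentiableAt ℝ (chartCov α x) z := fun z hz ↦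
    (hball z hz).1.differentiableAt one_ne_zero
  -- Closedness is known in the preferred chart of each point and is moved to the chart at `x`.
  have hsymm : ∀ z ∈ B, ∀ u v, fderiv ℝ (chartCov α x) z u v = fderiv ℝ (chartCov α x) z v u := by
    intro z hz
    have hzt : z ∈ (extChartAt (𝓡 m) x).target := (hball z hz).2
    refine fderiv_symmetric_of_extDeriv_eq_zero (hdiff z hz) ?_
    have hform : DifferentiableAt ℝ (chartForm (fun y ↦ form1 (α y)) x) z :=
      ((ContinuousAlternatingMap.ofSubsingletonLIE (𝕜 := ℝ) (E := EuclideanSpace ℝ (Fin m)) (F := ℝ)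
        (0 : Fin 1)).differentiableAt (x := chartCov α x z)).comp z (hdiff z hz)
    have h2 := extD_eq_pullback ((extChartAt (𝓡 m) x).map_target hzt) (θ := fun y ↦ form1 (α y))
      (by rwa [(extChartAt (𝓡 m) x).right_inv hzt])
    rw [hd, (extChartAt (𝓡 m) x).right_inv hzt] at h2
    ext v
    have h3 := DFunLike.congr_fun h2 (fun i ↦ mfderiv 𝓘(ℝ, EuclideanSpace ℝ (Fin m)) (𝓡 m)
      (extChartAt (𝓡 m) x).symm z (v i))
    exact (congrArg (extDeriv (chartForm (fun y ↦ form1 (α y)) x) z)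
      (funext fun i ↦ (mfderiv_comp_mfderiv_symm hzt (v i)).symm)).trans h3.symm
  obtain ⟨s, hs⟩ := (convex_ball _ r).exists_forall_hasFDerivAt_of_fderiv_symmetric
    Metric.isOpen_ball (fun z hz ↦ (hdiff z hz).differentiableWithinAt) hsymm
  refine ⟨(extChartAt (𝓡 m) x).source ∩ extChartAt (𝓡 m) x ⁻¹' B, s ∘ extChartAt (𝓡 m) x,
    isOpen_extChartAt_preimage' (I := 𝓡 m) x Metric.isOpen_ball, ⟨mem_extChartAt_source x,
      Metric.mem_ball_self hr⟩, ?_⟩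
  rintro p ⟨hp, hpB⟩
  have h2 := mdifferentiableAt_chart hp
  have h3 : HasMFDerivAt 𝓘(ℝ, EuclideanSpace ℝ (Fin m)) 𝓘(ℝ, ℝ) s (extChartAt (𝓡 m) x p)
    (chartCov α x (extChartAt (𝓡 m) x p)) := (hs _ hpB).hasMFDerivAt
  have h4 := h3.comp p h2.hasMFDerivAt
  refine ⟨h4.mdifferentiableAt, ?_⟩
  rw [diff, h4.mfderiv]
  ext v
  -- The base points are equal only propositionally, so both arguments are transported at once.
  have key : ∀ z z' : M, z = z' → ∀ V V' : EuclideanSpace ℝ (Fin m), V = V' →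
      α z V = α z' V' := by
    rintro z _ rfl V _ rfl; rfl
  exact key _ _ ((extChartAt (𝓡 m) x).left_inv hp) _ _ (mfderiv_symm_comp_mfderiv hp v)

/-! ### Almost contact metric structures and their rescalings -/

namespace AlmostContactMetric

variable (S : AlmostContactMetric m M)

theorem g_φ_swap (x : M) (v w : TangentSpace (𝓡 m) x) :
    S.g x v (S.φ x w) = -S.g x w (S.φ x v) := by
  have h := S.g_φ_self x (v + w)
  simp only [map_add, _root_.add_apply, g_φ_self] at h
  linarith

theorem differentiableAt_chartForm_η [IsManifold (𝓡 m) ∞ M] (hS : S.SmoothOn univ) (x : M) :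
    DifferentiableAt ℝ (chartForm (fun y ↦ form1 (S.η y)) x) (extChartAt (𝓡 m) x x) := by
  have h := (smoothCovectorAt_iff.1 ((hS.η x (mem_univ x)).contMDiffAt univ_mem)).differentiableAt
    (by simp)
  exact ((ContinuousAlternatingMap.ofSubsingletonLIE (𝕜 := ℝ) (E := EuclideanSpace ℝ (Fin m))
    (F := ℝ) (0 : Fin 1)).differentiableAt
      (x := chartCov S.η x (extChartAt (𝓡 m) x x))).comp _ h

/-- The expression of `φ` in the preferred chart at `x` is differentiable. Off the chart target the
witness has no meaning, so it is described only on the target. -/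
theorem exists_chart_φ [IsManifold (𝓡 m) ∞ M] (hS : S.SmoothOn univ) (x : M) :
    ∃ F : EuclideanSpace ℝ (Fin m) → EuclideanSpace ℝ (Fin m) →L[ℝ] EuclideanSpace ℝ (Fin m),
      DifferentiableAt ℝ F (extChartAt (𝓡 m) x x) ∧
      ∀ y ∈ (extChartAt (𝓡 m) x).target, ∀ w, F y w =
        mfderiv (𝓡 m) 𝓘(ℝ, EuclideanSpace ℝ (Fin m)) (extChartAt (𝓡 m) x)
          ((extChartAt (𝓡 m) x).symm y) (S.φ _ (mfderiv 𝓘(ℝ, EuclideanSpace ℝ (Fin m)) (𝓡 m)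
            (extChartAt (𝓡 m) x).symm y w)) := by
  have hφ := (hS.φ x (mem_univ x)).contMDiffAt univ_mem
  rw [contMDiffAt_hom_bundle] at hφ
  refine ⟨_, (contMDiffAt_iff_contDiffAt_chart.1
    hφ.2).differentiableAt (by simp), fun y hy w ↦ ?_⟩
  have hL := TangentBundle.symmL_trivializationAt (I := 𝓡 m) (extChartAt_symm_mem_source hy)
  rw [(extChartAt (𝓡 m) x).right_inv hy, ModelWithCorners.range_eq_univ, mfderivWithin_univ] at hL
  have hC := TangentBundle.continuousLinearMapAt_trivializationAt (I := 𝓡 m)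
    (extChartAt_symm_mem_source hy)
  simp only [Function.comp_apply, ContinuousLinearMap.inCoordinates, hL, hC]
  rfl

/-- The expression of `g` in the preferred chart at `x` is differentiable. -/
theorem exists_chart_g [IsManifold (𝓡 m) ∞ M] (hS : S.SmoothOn univ) (x : M) :
    ∃ G : EuclideanSpace ℝ (Fin m) → EuclideanSpace ℝ (Fin m) →L[ℝ]
        EuclideanSpace ℝ (Fin m) →L[ℝ] ℝ,
      DifferentiableAt ℝ G (extChartAt (𝓡 m) x x) ∧
      ∀ y ∈ (extChartAt (𝓡 m) x).target, ∀ v w, G y v w = S.g ((extChartAt (𝓡 m) x).symm y)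
        (mfderiv 𝓘(ℝ, EuclideanSpace ℝ (Fin m)) (𝓡 m) (extChartAt (𝓡 m) x).symm y v)
        (mfderiv 𝓘(ℝ, EuclideanSpace ℝ (Fin m)) (𝓡 m) (extChartAt (𝓡 m) x).symm y w) := by
  have hg := (hS.g x (mem_univ x)).contMDiffAt univ_mem
  rw [contMDiffAt_hom_bundle] at hg
  refine ⟨_, (contMDiffAt_iff_contDiffAt_chart.1
    hg.2).differentiableAt (by simp), fun y hy v w ↦ ?_⟩
  have hL := TangentBundle.symmL_trivializationAt (I := 𝓡 m) (extChartAt_symm_mem_source hy)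
  rw [(extChartAt (𝓡 m) x).right_inv hy, ModelWithCorners.range_eq_univ, mfderivWithin_univ] at hL
  have hs := extChartAt_symm_mem_source hy
  rw [Function.comp_apply, inCoordinates_apply_eq₂ (by simpa using hs) (by simpa using hs)
    (by simp)]
  have hL' : ∀ u, (trivializationAt (EuclideanSpace ℝ (Fin m)) (TangentSpace (𝓡 m)) x).symm
      ((extChartAt (𝓡 m) x).symm y) u = mfderiv 𝓘(ℝ, EuclideanSpace ℝ (Fin m)) (𝓡 m)
        (extChartAt (𝓡 m) x).symm y u := fun u ↦
    (Bundle.Trivialization.symmL_apply _ (by simpa using hs) u).symm.trans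
      (DFunLike.congr_fun hL u)
  rw [hL', hL']
  exact congrFun (congrArg DFunLike.coe (Bundle.Trivial.linearMapAt_trivialization ℝ M ℝ _)) _

/-- In the chart at `x`, `Φ(v, w)` is `G(v, F w)` for the expressions `F` of `φ` and `G` of `g`; it is
recovered as the alternating part of this bilinear form. -/
theorem differentiableAt_chartForm_Φ [IsManifold (𝓡 m) ∞ M] (hS : S.SmoothOn univ) (x : M) :
    DifferentiableAt ℝ (chartForm S.Φ x) (extChartAt (𝓡 m) x x) := by
  obtain ⟨F, hF, hFy⟩ := S.exists_chart_φ hS x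
  obtain ⟨G, hG, hGy⟩ := S.exists_chart_g hS x
  refine (differentiableAt_bilinToForm_comp hF hG).congr_of_eventuallyEq ?_
  filter_upwards [extChartAt_target_mem_nhds (I := 𝓡 m) x] with y hy
  have key : ∀ v w : EuclideanSpace ℝ (Fin m), G y v (F y w) =
      S.g ((extChartAt (𝓡 m) x).symm y)
        (mfderiv 𝓘(ℝ, EuclideanSpace ℝ (Fin m)) (𝓡 m) (extChartAt (𝓡 m) x).symm y v)
        (S.φ _ (mfderiv 𝓘(ℝ, EuclideanSpace ℝ (Fin m)) (𝓡 m) (extChartAt (𝓡 m) x).symm y w)) := by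
    intro v w
    rw [hGy y hy, hFy y hy]
    congr 1
    have h := mfderiv_symm_comp_mfderiv ((extChartAt (𝓡 m) x).map_target hy)
      (S.φ _ (mfderiv 𝓘(ℝ, EuclideanSpace ℝ (Fin m)) (𝓡 m) (extChartAt (𝓡 m) x).symm y w))
    rwa [(extChartAt (𝓡 m) x).right_inv hy] at h
  ext v
  have h1 : chartForm S.Φ x y v = G y (v 0) (F y (v 1)) := (key _ _).symm
  have h2 : G y (v 1) (F y (v 0)) = -G y (v 0) (F y (v 1)) := by
    rw [key, key]
    exact S.g_φ_swap _ _ _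
  rw [h1, bilinToForm_apply]
  simp only [ContinuousLinearMap.comp_apply, precompCLM, ContinuousLinearMap.flip_apply,
    ContinuousLinearMap.compL_apply, h2]
  ring

/-- Only the metric contributes to the rescaling of `Φ`, since `φ` is unchanged. -/
theorem rescale_Φ (σ : M → ℝ) :
    (S.rescale σ).Φ = fun x ↦ Real.exp (-2 * σ x) • S.Φ x := by
  funext x
  ext v
  rfl

theorem form1_rescale_η (σ : M → ℝ) :
    (fun x ↦ form1 ((S.rescale σ).η x)) = fun x ↦ Real.exp (-1 * σ x) • form1 (S.η x) := by
  funext x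
  rw [neg_one_mul]
  ext v
  rfl

/-- From `d(e^{-σ} η) = e^{-σ} (dη - dσ ∧ η)`. -/
theorem extD_rescale_η_eq_zero_iff [IsManifold (𝓡 m) ∞ M] (hS : S.SmoothOn univ) {σ : M → ℝ}
    {x : M}
    (hσ : MDifferentiableAt (𝓡 m) 𝓘(ℝ, ℝ) σ x) :
    extD (fun y ↦ form1 ((S.rescale σ).η y)) x = 0 ↔
      extD (fun y ↦ form1 (S.η y)) x =
        wedge (V := EuclideanSpace ℝ (Fin m)) (diff (m := m) σ x) (form1 (S.η x)) := by
  obtain ⟨h1, h2⟩ := diff_exp_mul (-1) hσ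
  obtain ⟨d, hd⟩ : ∃ d : EuclideanSpace ℝ (Fin m) [⋀^Fin 2]→L[ℝ] ℝ,
    extD (fun y ↦ form1 (S.η y)) x = d := ⟨_, rfl⟩
  rw [form1_rescale_η, extD_smul hd h1 (S.differentiableAt_chartForm_η hS x), h2, hd]
  have h3 : wedge (V := EuclideanSpace ℝ (Fin m))
      ((-1 * Real.exp (-1 * σ x)) • diff (m := m) σ x) (form1 (S.η x)) =
      (-1 * Real.exp (-1 * σ x)) •
        wedge (V := EuclideanSpace ℝ (Fin m)) (diff (m := m) σ x) (form1 (S.η x)) :=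
    wedge_smul_left _ _ _
  rw [h3]
  generalize wedge (V := EuclideanSpace ℝ (Fin m)) (diff (m := m) σ x) (form1 (S.η x)) = w
  have h4 : Real.exp (-1 * σ x) • d + (-1 * Real.exp (-1 * σ x)) • w =
      Real.exp (-1 * σ x) • (d - w) := by module
  rw [h4]
  refine Iff.trans ?_ sub_eq_zero
  exact smul_eq_zero_iff_right (Real.exp_pos _).ne'

/-- From `d(e^{-2σ} Φ) = e^{-2σ} (dΦ - 2 dσ ∧ Φ)`; on the right-hand side the factors `e^σ` of the
function and `e^{-σ}` of the contact form cancel. -/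
theorem extD_rescale_Φ_eq_iff [IsManifold (𝓡 m) ∞ M] (hS : S.SmoothOn univ) {σ f : M → ℝ} {x : M}
    (hσ : MDifferentiableAt (𝓡 m) 𝓘(ℝ, ℝ) σ x) :
    extD (S.rescale σ).Φ x = (2 * (f x * Real.exp (σ x))) •
        wedge (V := EuclideanSpace ℝ (Fin m)) ((S.rescale σ).η x) ((S.rescale σ).Φ x) ↔
      extD S.Φ x = (2 * f x) • wedge (V := EuclideanSpace ℝ (Fin m)) (S.η x) (S.Φ x) +
        (2 : ℝ) • wedge (V := EuclideanSpace ℝ (Fin m)) (diff (m := m) σ x) (S.Φ x) := by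
  obtain ⟨h1, h2⟩ := diff_exp_mul (-2) hσ
  obtain ⟨d, hd⟩ : ∃ d : EuclideanSpace ℝ (Fin m) [⋀^Fin 3]→L[ℝ] ℝ, extD S.Φ x = d := ⟨_, rfl⟩
  rw [rescale_Φ, extD_smul hd h1 (S.differentiableAt_chartForm_Φ hS x), h2, hd]
  have h3 : wedge (V := EuclideanSpace ℝ (Fin m))
      ((-2 * Real.exp (-2 * σ x)) • diff (m := m) σ x) (S.Φ x) =
      (-2 * Real.exp (-2 * σ x)) • wedge (V := EuclideanSpace ℝ (Fin m)) (diff (m := m) σ x) (S.Φ x) :=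
    wedge_smul_left _ _ _
  have h4 : wedge (V := EuclideanSpace ℝ (Fin m)) ((S.rescale σ).η x)
      (Real.exp (-2 * σ x) • S.Φ x) =
      Real.exp (-σ x) • Real.exp (-2 * σ x) •
        wedge (V := EuclideanSpace ℝ (Fin m)) (S.η x) (S.Φ x) :=
    (wedge_smul_left (V := EuclideanSpace ℝ (Fin m)) (Real.exp (-σ x)) (S.η x) _).trans
      (congrArg _ (wedge_smul_right _ _ _))
  have h5 : Real.exp (σ x) * Real.exp (-σ x) = 1 := by rw [← Real.exp_add]; simp
  rw [h3, h4]
  generalize wedge (V := EuclideanSpace ℝ (Fin m)) (diff (m := m) σ x) (S.Φ x) = w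
  generalize wedge (V := EuclideanSpace ℝ (Fin m)) (S.η x) (S.Φ x) = w'
  have h6 : (2 * (f x * Real.exp (σ x))) • Real.exp (-σ x) • Real.exp (-2 * σ x) • w' =
      Real.exp (-2 * σ x) • ((2 * f x) • w') := by
    rw [smul_smul, smul_smul, smul_smul]
    congr 1
    linear_combination (2 * f x * Real.exp (-2 * σ x)) * h5
  have h7 : Real.exp (-2 * σ x) • d + (-2 * Real.exp (-2 * σ x)) • w =
      Real.exp (-2 * σ x) • (d - (2 : ℝ) • w) := by module
  rw [h6, h7]
  exact (smul_right_inj (Real.exp_pos _).ne').trans sub_eq_iff_eq_add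

theorem SmoothOn.mono [IsManifold (𝓡 m) ∞ M] {S : AlmostContactMetric m M} {U V : Set M}
    (hS : S.SmoothOn V) (h : U ⊆ V) : S.SmoothOn U :=
  ⟨hS.φ.mono h, hS.ξ.mono h, ContMDiffOn.mono hS.η h, hS.g.mono h⟩

set_option synthInstance.maxHeartbeats 200000 in
theorem SmoothOn.rescale [IsManifold (𝓡 m) ∞ M] {S : AlmostContactMetric m M} {U : Set M}
    (hS : S.SmoothOn U) {σ : M → ℝ} (hσ : ContMDiffOn (𝓡 m) 𝓘(ℝ, ℝ) ∞ σ U) :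
    (S.rescale σ).SmoothOn U where
  φ := hS.φ
  ξ := ContMDiffOn.smul_section (Real.contDiff_exp.contMDiff.comp_contMDiffOn hσ) hS.ξ
  η := ContMDiffOn.smul_section (V := fun x : M ↦ TangentSpace (𝓡 m) x →L[ℝ] Bundle.Trivial M ℝ x)
    ((Real.contDiff_exp.comp contDiff_neg).contMDiff.comp_contMDiffOn hσ) hS.η
  g := ContMDiffOn.smul_section (V := fun x : M ↦
      TangentSpace (𝓡 m) x →L[ℝ] TangentSpace (𝓡 m) x →L[ℝ] Bundle.Trivial M ℝ x)
    ((Real.contDiff_exp.comp (contDiff_const.mul contDiff_id)).contMDiff.comp_contMDiffOn hσ) hS.g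

theorem exists_η_eq_zero (hm : 1 < m) (x : M) :
    ∃ v : TangentSpace (𝓡 m) x, v ≠ 0 ∧ S.η x v = 0 := by
  have h : ∀ η : EuclideanSpace ℝ (Fin m) →L[ℝ] ℝ, ∃ v, v ≠ 0 ∧ η v = 0 := by
    intro η
    have := LinearMap.ker_ne_bot_of_finrank_lt (f := (η : EuclideanSpace ℝ (Fin m) →ₗ[ℝ] ℝ))
      (by simpa using hm)
    obtain ⟨v, hv, hv0⟩ := Submodule.exists_mem_ne_zero_of_ne_bot this
    exact ⟨v, hv0, hv⟩
  exact h (S.η x)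

/-- In dimension at least two, a covector is determined by its wedge products with `η` and `Φ`: for
`v ≠ 0` in the kernel of `η`, the value `Φ(v, φ v) = -g(v, v)` is not zero. -/
theorem covector_ext_of_wedge (hm : 1 < m) (x : M) {α β : TangentSpace (𝓡 m) x →L[ℝ] ℝ}
    (hη : wedge (V := EuclideanSpace ℝ (Fin m)) α (form1 (S.η x)) =
      wedge (V := EuclideanSpace ℝ (Fin m)) β (form1 (S.η x)))
    (hΦ : wedge (V := EuclideanSpace ℝ (Fin m)) α (S.Φ x) =
      wedge (V := EuclideanSpace ℝ (Fin m)) β (S.Φ x)) : α = β := by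
  obtain ⟨v, hv0, hv⟩ := S.exists_η_eq_zero hm x
  refine covector_eq_of_wedge_eq (V := EuclideanSpace ℝ (Fin m)) (η := S.η x) (Ω := S.Φ x)
    (S.η_ξ x) hv (S.η_φ x v) ?_ hη hΦ
  have h : S.g x v (S.φ x (S.φ x v)) = -S.g x v v := by
    rw [S.φ_sq, hv]
    simp
  have h' : S.Φ x ![v, S.φ x v] = -S.g x v v := h
  exact fun h0 ↦ (S.g_pos x v hv0).ne' (neg_eq_zero.1 (h'.symm.trans h0))

/-! ### Locally conformal structures and Lee forms -/

section LeeForm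

variable [IsManifold (𝓡 m) ∞ M] {S : AlmostContactMetric m M} {f : M → ℝ}

theorem IsLocalConformalData.contMDiffAt {ι : Type*} {U : ι → Set M} {σ : ι → M → ℝ}
    (h : S.IsLocalConformalData f U σ) {t : ι} {x : M} (hx : x ∈ U t) :
    ContMDiffAt (𝓡 m) 𝓘(ℝ, ℝ) ∞ (σ t) x :=
  (h.smooth t x hx).contMDiffAt ((h.isOpen t).mem_nhds hx)

theorem IsLocalConformalData.extD_η (hS : S.SmoothOn univ) {ι : Type*} {U : ι → Set M}
    {σ : ι → M → ℝ} (h : S.IsLocalConformalData f U σ) {t : ι} {x : M} (hx : x ∈ U t) :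
    extD (fun y ↦ form1 (S.η y)) x =
      wedge (V := EuclideanSpace ℝ (Fin m)) (diff (m := m) (σ t) x) (form1 (S.η x)) :=
  (S.extD_rescale_η_eq_zero_iff hS ((h.contMDiffAt hx).mdifferentiableAt (by simp))).1
    ((h.cosymplectic t).d_η x hx)

theorem IsLocalConformalData.extD_Φ (hS : S.SmoothOn univ) {ι : Type*} {U : ι → Set M}
    {σ : ι → M → ℝ} (h : S.IsLocalConformalData f U σ) {t : ι} {x : M} (hx : x ∈ U t) :
    extD S.Φ x = (2 * f x) • wedge (V := EuclideanSpace ℝ (Fin m)) (S.η x) (S.Φ x) +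
      (2 : ℝ) • wedge (V := EuclideanSpace ℝ (Fin m)) (diff (m := m) (σ t) x) (S.Φ x) :=
  (S.extD_rescale_Φ_eq_iff hS ((h.contMDiffAt hx).mdifferentiableAt (by simp))).1
    ((h.cosymplectic t).d_Φ x hx)

/-- The local differentials agree on overlaps, because `dη` and `dΦ` determine their wedge products with
`η` and `Φ`. -/
theorem IsLocalConformalData.diff_eq_diff (hm : 1 < m) (hS : S.SmoothOn univ) {ι : Type*}
    {U : ι → Set M} {σ : ι → M → ℝ} (h : S.IsLocalConformalData f U σ) {s t : ι} {x : M}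
    (hs : x ∈ U s) (ht : x ∈ U t) : diff (m := m) (σ s) x = diff (σ t) x := by
  refine S.covector_ext_of_wedge hm x ((h.extD_η hS hs).symm.trans (h.extD_η hS ht)) ?_
  have h1 := (h.extD_Φ hS hs).symm.trans (h.extD_Φ hS ht)
  exact smul_right_injective _ (two_ne_zero (α := ℝ)) (add_left_cancel h1)

theorem IsLocalConformalData.isLeeForm (hS : S.SmoothOn univ) {ι : Type*} {U : ι → Set M}
    {σ : ι → M → ℝ} (h : S.IsLocalConformalData f U σ)
    {lee : ∀ x : M, TangentSpace (𝓡 m) x →L[ℝ] ℝ}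
    (hlee : ∀ t, ∀ x ∈ U t, lee x = diff (σ t) x) : S.IsLeeForm f lee := by
  have hU : ∀ x, ∃ t, x ∈ U t := fun x ↦ mem_iUnion.1 (h.cover.symm ▸ mem_univ x)
  have hnear : ∀ t x, x ∈ U t → ∀ᶠ z in 𝓝 x, lee z = diff (σ t) z := fun t x hx ↦ by
    filter_upwards [(h.isOpen t).mem_nhds hx] with z hz using hlee t z hz
  refine ⟨fun x _ ↦ ?_, fun x ↦ ?_, fun x ↦ ?_, fun x ↦ ?_⟩ <;> obtain ⟨t, ht⟩ := hU x
  · refine (((smoothCovectorAt_diff_iff (eventually_mdifferentiableAt (h.contMDiffAt ht))).2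
      (h.contMDiffAt ht)).congr_of_eventuallyEq ?_).contMDiffWithinAt
    filter_upwards [hnear t x ht] with z hz
    rw [hz]
  · rw [extD_congr (θ' := fun y ↦ form1 (diff (σ t) y)), extD_diff (h.contMDiffAt ht)]
    filter_upwards [hnear t x ht] with z hz
    rw [hz]
  · rw [hlee t x ht]
    exact h.extD_η hS ht
  · rw [hlee t x ht]
    exact h.extD_Φ hS ht

theorem IsLocalConformalData.exists_leeForm (hm : 1 < m) (hS : S.SmoothOn univ) {ι : Type*}
    {U : ι → Set M} {σ : ι → M → ℝ} (h : S.IsLocalConformalData f U σ) :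
    ∃ lee : ∀ x : M, TangentSpace (𝓡 m) x →L[ℝ] ℝ, S.IsLeeForm f lee ∧
      ∀ t, ∀ x ∈ U t, lee x = diff (σ t) x := by
  choose t ht using fun x ↦ mem_iUnion.1 (h.cover.symm ▸ mem_univ x)
  have hlee : ∀ s, ∀ x ∈ U s, diff (m := m) (σ (t x)) x = diff (σ s) x :=
    fun s x hx ↦ h.diff_eq_diff hm hS (ht x) hx
  exact ⟨fun x ↦ diff (σ (t x)) x, h.isLeeForm hS hlee, hlee⟩

theorem IsLeeForm.exists_localConformalData {M : Type u} [TopologicalSpace M]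
    [ChartedSpace (EuclideanSpace ℝ (Fin m)) M] [IsManifold (𝓡 m) ∞ M]
    {S : AlmostContactMetric m M} {f : M → ℝ} (hS : S.SmoothOn univ)
    (hf : ContMDiff (𝓡 m) 𝓘(ℝ, ℝ) ∞ f) {lee : ∀ x : M, TangentSpace (𝓡 m) x →L[ℝ] ℝ}
    (h : S.IsLeeForm f lee) :
    ∃ (ι : Type u) (U : ι → Set M) (σ : ι → M → ℝ), S.IsLocalConformalData f U σ ∧
      ∀ t, ∀ x ∈ U t, lee x = diff (σ t) x := by
  choose U σ hU hxU hσ using exists_local_primitive h.smooth h.closed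
  have hsmooth : ∀ t, ContMDiffOn (𝓡 m) 𝓘(ℝ, ℝ) ∞ (σ t) (U t) := by
    intro t x hx
    have hn : ∀ᶠ z in 𝓝 x, z ∈ U t := (hU t).mem_nhds hx
    refine ((smoothCovectorAt_diff_iff (hn.mono fun z hz ↦ (hσ t z hz).1)).1 ?_).contMDiffWithinAt
    refine ((h.smooth x (mem_univ x)).contMDiffAt univ_mem).congr_of_eventuallyEq ?_
    filter_upwards [hn] with z hz
    rw [(hσ t z hz).2]
  refine ⟨M, U, σ, ⟨hU, eq_univ_of_forall fun x ↦ mem_iUnion.2 ⟨x, hxU x⟩, hsmooth, fun t ↦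
    ⟨(hS.mono (subset_univ _)).rescale (hsmooth t), ?_, fun x hx ↦ ?_, fun x hx ↦ ?_⟩⟩,
    fun t x hx ↦ (hσ t x hx).2.symm⟩
  · exact hf.contMDiffOn.mul (Real.contDiff_exp.contMDiff.comp_contMDiffOn (hsmooth t))
  · rw [S.extD_rescale_η_eq_zero_iff hS (hσ t x hx).1, (hσ t x hx).2]
    exact h.d_η x
  · rw [S.extD_rescale_Φ_eq_iff hS (hσ t x hx).1, (hσ t x hx).2]
    exact h.d_Φ x

/-- In dimension one every closedness and wedge condition is an equation between forms of degree at
least two. The zero form is written as the differential of a constant, whose smoothness is known. -/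
theorem isLeeForm_zero_of_dim_one {M : Type*} [TopologicalSpace M]
    [ChartedSpace (EuclideanSpace ℝ (Fin 1)) M] [IsManifold (𝓡 1) ∞ M]
    (S : AlmostContactMetric 1 M) (f : M → ℝ) :
    S.IsLeeForm f (fun x ↦ diff (fun _ ↦ (0 : ℝ)) x) := by
  have hz : ∀ {k : ℕ} (β β' : EuclideanSpace ℝ (Fin 1) [⋀^Fin (k + 2)]→L[ℝ] ℝ), β = β' :=
    fun β β' ↦ (alternating_eq_zero_of_finrank_lt (by simp) β).trans
      (alternating_eq_zero_of_finrank_lt (by simp) β').symm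
  refine ⟨fun x _ ↦ ?_, fun x ↦ hz _ _, fun x ↦ hz _ _, fun x ↦ hz _ _⟩
  exact ((smoothCovectorAt_diff_iff (.of_forall fun z ↦ mdifferentiableAt_const)).2
    contMDiffAt_const).contMDiffWithinAt

end LeeForm

end AlmostContactMetric

end

end ACM

theorem theorem3p1 {n : ℕ} {M : Type u} [TopologicalSpace M]
    [ChartedSpace (EuclideanSpace ℝ (Fin (2 * n + 1))) M] [IsManifold (𝓡 (2 * n + 1)) ∞ M]
    (S : ACM.AlmostContactMetric (2 * n + 1) M) (hS : S.SmoothOn univ)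
    (f : M → ℝ) (hf : ContMDiff (𝓡 (2 * n + 1)) 𝓘(ℝ, ℝ) ∞ f) :
    (S.IsLocallyConformal f ↔
      ∃ lee : ∀ x : M, TangentSpace (𝓡 (2 * n + 1)) x →L[ℝ] ℝ, S.IsLeeForm f lee) ∧
    (1 ≤ n → ∀ (ι : Type v) (U : ι → Set M) (σ : ι → M → ℝ), S.IsLocalConformalData f U σ →
      ∃ lee : ∀ x : M, TangentSpace (𝓡 (2 * n + 1)) x →L[ℝ] ℝ, S.IsLeeForm f lee ∧
        ∀ t, ∀ x ∈ U t, lee x = ACM.diff (σ t) x) ∧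
    (∀ lee : ∀ x : M, TangentSpace (𝓡 (2 * n + 1)) x →L[ℝ] ℝ, S.IsLeeForm f lee →
      ∃ (ι : Type u) (U : ι → Set M) (σ : ι → M → ℝ), S.IsLocalConformalData f U σ ∧
        ∀ t, ∀ x ∈ U t, lee x = ACM.diff (σ t) x) := by
  refine ⟨⟨?_, ?_⟩, ?_, fun lee h ↦ h.exists_localConformalData hS hf⟩
  · rintro ⟨ι, U, σ, h⟩
    rcases Nat.eq_zero_or_pos n with rfl | hn
    · exact ⟨_, S.isLeeForm_zero_of_dim_one f⟩
    · obtain ⟨lee, hlee, -⟩ := h.exists_leeForm (by omega) hS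
      exact ⟨lee, hlee⟩
  · rintro ⟨lee, h⟩
    obtain ⟨ι, U, σ, hd, -⟩ := h.exists_localConformalData hS hf
    exact ⟨ι, U, σ, hd⟩
  · intro hn ι U σ h
    exact h.exists_leeForm (by omega) hS
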